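/- Let $F_2=\langle x,y\rangle$ be the free group of rank $2$, let $\varphi\in\mathrm{Aut}(F_2)$, and let $$G=F_2\rtimes_\varphi\mathbb{Z}=\langle x,y,t \mid t^{-1}xt=\varphi(x),\ t^{-1}yt=\varphi(y)\rangle .$$ Let $[\overline\varphi]\in\mathrm{GL}_2(\mathbb{Z})$ be the matrix, in the basis given by the classes of $x$ and $y$, of the automorphism $\overline\varphi$ of $F_2/[F_2,F_2]\cong\mathbb{Z}^2$ induced by $\varphi$. A group is called residually nilpotent (respectively, for a prime $p$, residually $p$-finite) if for every non-identity element $g$ there is a normal subgroup $N$ with $g\notin N$ such that the quotient by $N$ is nilpotent (respectively, a finite $p$-group). Then: 1. $G$ is residually nilpotent if and only if either $\det[\overline\varphi]=1$ and $\mathrm{tr}[\overline\varphi]\notin\{1,3\}$, or $\det[\overline\varphi]=-1$ and $\mathrm{tr}[\overline\varphi]$ is even. 2. If $\det[\overline\varphi]=1$, then $G$ is residually $p$-finite for every prime $p$ dividing $\mathrm{tr}[\overline\varphi]-2$ (for every prime $p$ if $\mathrm{tr}[\overline\varphi]=2$). 3. If $\det[\overline\varphi]=-1$ and $\mathrm{tr}[\overline\varphi]$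 is even, then $G$ is residually $2$-finite. -/

import Mathlib

/-- A group is residually nilpotent if every non-identity element lies outside some normal
subgroup with nilpotent quotient. -/
def IsResiduallyNilpotent (G : Type*) [Group G] : Prop :=
  ∀ g : G, g ≠ 1 → ∃ (N : Subgroup G) (_ : N.Normal), g ∉ N ∧ Group.IsNilpotent (G ⧸ N)

/-- A group is residually `p`-finite if every non-identity element lies outside some normal
subgroup whose quotient is a finite `p`-group. -/
def IsResiduallyPFinite (p : ℕ) (G : Type*) [Group G] : Prop :=
  ∀ g : G, g ≠ 1 →
    ∃ (N : Subgroup G) (_ : N.Normal), g ∉ N ∧ Finite (G ⧸ N) ∧ IsPGroup p (G ⧸ N)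

namespace FreeByCyclic

/-- The free group `F₂` on two generators. -/
abbrev F2 : Type := FreeGroup (Fin 2)

/-- The action of the infinite cyclic group on `F₂` in which the generator `t` acts by `φ⁻¹`.
In Mathlib's semidirect product `t * w * t⁻¹` is the result of `t` acting on `w`,
so this is the action for which `t⁻¹ * w * t = φ w`. -/
def action (φ : MulAut F2) : Multiplicative ℤ →* MulAut F2 :=
  zpowersHom (MulAut F2) φ⁻¹

/-- The group `F₂ ⋊_φ ℤ = ⟨x, y, t | t⁻¹ x t = φ x, t⁻¹ y t = φ y⟩`. -/
abbrev G (φ : MulAut F2) : Type := F2 ⋊[action φ] Multiplicative ℤ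

/-- The stable letter `t`, a generator of the infinite cyclic factor. -/
def t (φ : MulAut F2) : G φ := SemidirectProduct.inr (Multiplicative.ofAdd 1)

/-- The defining relations of `F₂ ⋊_φ ℤ`. -/
theorem conj_t (φ : MulAut F2) (w : F2) :
    (t φ)⁻¹ * (SemidirectProduct.inl w : G φ) * t φ = SemidirectProduct.inl (φ w) := by
  have h := SemidirectProduct.inl_aut_inv (φ := action φ) (Multiplicative.ofAdd 1) w
  rw [map_inv SemidirectProduct.inr] at h
  have ha : (action φ (Multiplicative.ofAdd 1))⁻¹ = φ := by simp [action]
  rw [ha] at h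
  exact h.symm

/-- The automorphism of the abelianization of `F₂`, written additively, induced by `φ`.
Mathlib's `FreeAbelianGroup α` is by definition `Additive (Abelianization (FreeGroup α))`. -/
def inducedAut (φ : MulAut F2) : FreeAbelianGroup (Fin 2) ≃+ FreeAbelianGroup (Fin 2) :=
  MulEquiv.toAdditive (MulEquiv.abelianizationCongr φ)

/-- The integral `2 × 2` matrix of the induced automorphism, in the basis formed by the classes of
the two free generators. -/
noncomputable def inducedMatrix (φ : MulAut F2) : Matrix (Fin 2) (Fin 2) ℤ :=
  LinearMap.toMatrix (FreeAbelianGroup.basis (Fin 2)) (FreeAbelianGroup.basis (Fin 2))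
    (inducedAut φ).toIntLinearEquiv.toLinearMap

end FreeByCyclic

/-! ### The induced matrix and its action on homomorphisms to abelian groups -/

namespace FreeByCyclic

/-! Write `A` for the induced matrix. Sufficiency: if a prime `p` divides `tr A - 2` and `det A -
1`, then `A` is unipotent modulo `p`. Hence for every finite `p`-group `P`, `φ` permutes `Hom(F₂,
P)` with `p`-power order (`comp_pow_prime_pow_eq`, by induction along central quotients). So `G`
maps to a wreath product of `P` with a cyclic `p`-group, extending the evaluation of `F₂` at all
homomorphisms. Since `F₂` is residually `p`-finite (Sanov matrices), so is `G`. For `det A = 1` such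
a `p` exists unless `tr A - 2 = ±1`; for `det A = -1` and even trace, `p = 2` works.

Necessity: let `m = det (A - 1) = 1 - tr A + det A` and let `c` be the commutator of the generators.
Cramer's rule gives `w ^ m ∈ ⁅F₂, G⁆` for `w` in `F₂`, whence `c ^ m ^ n` lies in the `n`-th lower
central term. If `m = ±1`, then `c` lies in all of them. If `det A = -1`, the same argument puts `c
^ 2 ^ n` there, because `φ` inverts `c` modulo higher commutators; when `m` is odd, Bézout again
puts `c` in every term. -/

theorem inducedAut_basis (φ : MulAut F2) (j : Fin 2) :
    inducedAut φ (FreeAbelianGroup.of j) =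
      ∑ i, inducedMatrix φ i j • FreeAbelianGroup.of i := by
  have h := (FreeAbelianGroup.basis (Fin 2)).sum_repr (inducedAut φ (FreeAbelianGroup.of j))
  have hb : ∀ i, FreeAbelianGroup.basis (Fin 2) i = FreeAbelianGroup.of i := fun i => by
    simp [FreeAbelianGroup.basis, FreeAbelianGroup.equivFinsupp]
  rw [← h]
  refine Finset.sum_congr rfl fun i _ => ?_
  rw [hb, inducedMatrix, LinearMap.toMatrix_apply, hb]
  rfl

/-- Homomorphisms to commutative groups see an automorphism through its induced matrix. -/
theorem map_aut_of (φ : MulAut F2) {C : Type*} [CommGroup C] (f : F2 →* C) (j : Fin 2) :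
    f (φ (FreeGroup.of j)) = ∏ i, f (FreeGroup.of i) ^ inducedMatrix φ i j := by
  let g : FreeAbelianGroup (Fin 2) →+ Additive C := MonoidHom.toAdditive (Abelianization.lift f)
  have h := congrArg g (inducedAut_basis φ j)
  rw [map_sum] at h
  simp only [map_zsmul] at h
  exact congrArg Additive.toMul h

theorem inducedMatrix_mul (φ ψ : MulAut F2) :
    inducedMatrix (φ * ψ) = inducedMatrix φ * inducedMatrix ψ := by
  unfold inducedMatrix
  rw [← LinearMap.toMatrix_comp]
  congr 1
  ext x
  induction x using FreeAbelianGroup.induction_on with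
  | zero => simp
  | of x => rfl
  | neg x h => simp only [map_neg, h]
  | add x y hx hy => simp only [map_add, hx, hy]

theorem inducedMatrix_one : inducedMatrix 1 = 1 := by
  unfold inducedMatrix
  rw [← LinearMap.toMatrix_id (FreeAbelianGroup.basis (Fin 2))]
  congr 1
  ext x
  induction x using FreeAbelianGroup.induction_on with
  | zero => simp
  | of x => rfl
  | neg x h => simp only [map_neg, h]
  | add x y hx hy => simp only [map_add, hx, hy]

theorem inducedMatrix_pow (φ : MulAut F2) (n : ℕ) :
    inducedMatrix (φ ^ n) = inducedMatrix φ ^ n := by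
  induction n with
  | zero => simp [inducedMatrix_one]
  | succ n ih => rw [pow_succ, inducedMatrix_mul, ih, pow_succ]

theorem det_inducedMatrix (φ : MulAut F2) :
    (inducedMatrix φ).det = 1 ∨ (inducedMatrix φ).det = -1 := by
  have h : (inducedMatrix φ).det * (inducedMatrix φ⁻¹).det = 1 := by
    rw [← Matrix.det_mul, ← inducedMatrix_mul, mul_inv_cancel, inducedMatrix_one, Matrix.det_one]
  exact Int.isUnit_iff.mp (IsUnit.of_mul_eq_one _ h)

/-- An automorphism whose matrix is trivial modulo `n` acts trivially on homomorphisms to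
commutative groups of exponent dividing `n`. -/
theorem map_aut_eq_of_matrix_eq_one {φ : MulAut F2} {n : ℕ}
    (h : (inducedMatrix φ).map (Int.cast : ℤ → ZMod n) = 1)
    {C : Type*} [CommGroup C] (hC : ∀ c : C, c ^ n = 1) (f : F2 →* C) (w : F2) :
    f (φ w) = f w := by
  have hz : ∀ (c : C) (a b : ℤ), (a : ZMod n) = b → c ^ a = c ^ b := by
    intro c a b hab
    obtain ⟨k, hk⟩ := (ZMod.intCast_eq_intCast_iff_dvd_sub a b n).mp hab
    rw [show b = a + n * k by linarith, zpow_add, zpow_mul, zpow_natCast, hC, one_zpow, mul_one]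
  have : f.comp φ.toMonoidHom = f := by
    ext j
    have hj : ∀ i, f (FreeGroup.of i) ^ inducedMatrix φ i j =
        f (FreeGroup.of i) ^ (if i = j then 1 else 0 : ℤ) := fun i => hz _ _ _ <| by
      have := congrFun (congrFun h i) j
      rw [Matrix.map_apply, Matrix.one_apply] at this
      rw [this]; split_ifs <;> simp
    change f (φ (FreeGroup.of j)) = f (FreeGroup.of j)
    rw [map_aut_of]
    simp only [hj]
    simp [Finset.prod_ite_eq', apply_ite]
  exact DFunLike.congr_fun this w

end FreeByCyclic

/-! ### Congruence subgroups, and `F₂` is residually a finite `p`-group -/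

/-- If `A ≡ 1` modulo `p`, then `A ^ p ^ k ≡ 1` modulo `p ^ (k + 1)`. -/
theorem Matrix.pow_prime_pow_map_intCast_eq_one {n : Type*} [Fintype n] [DecidableEq n]
    {p : ℕ} {A : Matrix n n ℤ} (hA : A.map (Int.cast : ℤ → ZMod p) = 1) (k : ℕ) :
    (A ^ p ^ k).map (Int.cast : ℤ → ZMod (p ^ (k + 1))) = 1 := by
  have hd : ∀ i j, (p : ℤ) ∣ (A - 1) i j := fun i j => by
    rw [← ZMod.intCast_zmod_eq_zero_iff_dvd]
    have := congrFun (congrFun hA i) j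
    rw [Matrix.map_apply, Matrix.one_apply] at this
    rw [Matrix.sub_apply, Matrix.one_apply, Int.cast_sub, this]
    split_ifs <;> simp
  choose N hN using hd
  have hA' : A = 1 + (p : Matrix n n ℤ) * Matrix.of N := by
    ext i j
    have := hN i j
    rw [Matrix.sub_apply] at this
    rw [← nsmul_eq_mul, Matrix.add_apply, Matrix.smul_apply, Matrix.of_apply, nsmul_eq_mul]
    linarith
  -- The divisibility lemma needs a commutative ring, so it is applied in `ℤ[X]` and then evaluated
  -- at `N`.
  obtain ⟨q, hq⟩ := dvd_sub_pow_of_dvd_sub (R := Polynomial ℤ) (p := p)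
    (a := 1 + (p : Polynomial ℤ) * Polynomial.X) (b := 1) ⟨Polynomial.X, by ring⟩ k
  have h := congrArg (Polynomial.aeval (Matrix.of N)) hq
  simp only [map_sub, map_pow, map_add, map_mul, map_one, map_natCast, Polynomial.aeval_X,
    one_pow, ← hA'] at h
  rw [sub_eq_iff_eq_add] at h
  rw [h]
  ext i j
  rw [Matrix.map_apply, ← Nat.cast_pow, ← nsmul_eq_mul, Matrix.add_apply, Matrix.smul_apply,
    nsmul_eq_mul, Int.cast_add, Int.cast_mul, Int.cast_natCast, ZMod.natCast_self, zero_mul,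
    zero_add, Matrix.one_apply, Matrix.one_apply]
  split_ifs <;> simp

open ModularGroup UpperHalfPlane in
/-- The matrices `T ^ n` and `S T ^ n S⁻¹`, which freely generate a free group for `n ≥ 2`. -/
def sanovGenerators (n : ℕ) : Fin 2 → Matrix.SpecialLinearGroup (Fin 2) ℤ :=
  ![T ^ n, S * T ^ n * S⁻¹]

open ModularGroup UpperHalfPlane MatrixGroups in
theorem UpperHalfPlane.re_S_smul (z : ℍ) :
    (S • z).re = -z.re / (z.re ^ 2 + z.im ^ 2) := by
  rw [modular_S_smul, ← coe_re, coe_mk, Complex.inv_re, Complex.normSq_apply]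
  simp [pow_two]

open ModularGroup UpperHalfPlane MatrixGroups in
theorem UpperHalfPlane.abs_re_lt_one_of_one_le_abs_re_S_smul {z : ℍ} (h : 1 ≤ |(S • z).re|) :
    |z.re| < 1 := by
  have hy := z.im_pos
  have hpos : 0 < z.re ^ 2 + z.im ^ 2 := by positivity
  rw [re_S_smul, abs_div, abs_neg, abs_of_pos hpos, le_div_iff₀ hpos] at h
  nlinarith [sq_abs z.re, abs_nonneg z.re]

open ModularGroup UpperHalfPlane MatrixGroups in
-- Ping-pong on the upper half-plane: each generator is translation by `n` in the coordinate `c i •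
-- z`, and `|Re z| ≥ 1`, `|Re (S • z)| ≥ 1` cannot both hold. As `n ≥ 2`, a translation carries `Re
-- ≥ -1` into `Re ≥ 1`.
theorem lift_sanovGenerators_injective {n : ℕ} (hn : 2 ≤ n) :
    Function.Injective (FreeGroup.lift (sanovGenerators n)) := by
  have hn' : (2 : ℝ) ≤ n := by exact_mod_cast hn
  have hT : ∀ z : ℍ, (T ^ n • z).re = z.re + n := fun z => by
    simpa using re_T_zpow_smul z n
  have hT' : ∀ z : ℍ, ((T ^ n)⁻¹ • z).re = z.re - n := fun z => by
    simpa [sub_eq_add_neg] using re_T_zpow_smul z (-n)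
  let c : Fin 2 → SL(2, ℤ) := ![1, S⁻¹]
  have hc : ∀ i, sanovGenerators n i = (c i)⁻¹ * T ^ n * c i := by
    intro i; fin_cases i <;> simp [sanovGenerators, c]
  have hSS : ∀ z : ℍ, (S⁻¹ • z).re = (S • z).re := fun z => by
    have : (S⁻¹ : SL(2, ℤ)) = -S := by rw [inv_eq_iff_mul_eq_one]; decide
    rw [this, ModularGroup.SL_neg_smul]
  have key : ∀ i j, i ≠ j → ∀ z : ℍ, 1 ≤ |(c i • z).re| → ¬ 1 ≤ |(c j • z).re| := by
    have h01 : ∀ z : ℍ, 1 ≤ |(S⁻¹ • z).re| → ¬ 1 ≤ |((1 : SL(2, ℤ)) • z).re| := fun z h => by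
      rw [hSS] at h
      rw [one_smul]
      exact not_le.mpr (abs_re_lt_one_of_one_le_abs_re_S_smul h)
    intro i j hij z h1 h2
    fin_cases i <;> fin_cases j
    · exact hij rfl
    · exact h01 z h2 h1
    · exact h01 z h1 h2
    · exact hij rfl
  refine FreeGroup.injective_lift_of_ping_pong (α := ℍ) (sanovGenerators n)
    (fun i => {z | 1 ≤ (c i • z).re}) (fun i => {z | (c i • z).re < -1}) ?_ ?_ ?_ ?_ ?_ ?_
  · intro i
    refine ⟨(c i)⁻¹ • T ^ n • T ^ n • (T ^ n • I), ?_⟩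
    simp only [Set.mem_ofPred_eq, smul_inv_smul, hT, I_re]
    linarith
  · intro i j hij
    refine Set.disjoint_left.mpr fun z h1 h2 => key i j hij z ?_ ?_
    · exact le_trans h1 (le_abs_self _)
    · exact le_trans h2 (le_abs_self _)
  · intro i j hij
    refine Set.disjoint_left.mpr fun z h1 h2 => key i j hij z ?_ ?_
    · exact le_abs.mpr (Or.inr (by have : (c i • z).re < -1 := h1; linarith))
    · exact le_abs.mpr (Or.inr (by have : (c j • z).re < -1 := h2; linarith))
  · intro i j
    refine Set.disjoint_left.mpr fun z h1 h2 => ?_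
    simp only [Set.mem_ofPred_eq] at h1 h2
    rcases eq_or_ne i j with rfl | hij
    · linarith
    · exact key i j hij z (le_trans h1 (le_abs_self _)) (le_abs.mpr (Or.inr (by linarith)))
  · rintro i _ ⟨z, hz, rfl⟩
    simp only [Set.mem_compl_iff, Set.mem_ofPred_eq, not_lt] at hz ⊢
    simp only [hc, mul_smul, smul_inv_smul, hT]
    linarith
  · rintro i _ ⟨z, hz, rfl⟩
    simp only [Set.mem_compl_iff, Set.mem_ofPred_eq, not_le, Pi.inv_apply] at hz ⊢
    simp only [hc, mul_inv_rev, inv_inv, mul_smul, smul_inv_smul, hT']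
    linarith

open ModularGroup MatrixGroups in
theorem sanovGenerators_mem_Gamma (n : ℕ) (i : Fin 2) :
    sanovGenerators n i ∈ CongruenceSubgroup.Gamma n := by
  have hT : T ^ n ∈ CongruenceSubgroup.Gamma n := by
    rw [CongruenceSubgroup.Gamma_mem, ← zpow_natCast, coe_T_zpow]
    simp
  fin_cases i
  · exact hT
  · exact (CongruenceSubgroup.Gamma_normal n).conj_mem _ hT _

open MatrixGroups in
theorem isPGroup_map_Gamma (p k : ℕ) :
    IsPGroup p ((CongruenceSubgroup.Gamma p).map
      (Matrix.SpecialLinearGroup.map (n := Fin 2) (Int.castRingHom (ZMod (p ^ (k + 1)))))) := by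
  rintro ⟨_, g, hg, rfl⟩
  refine ⟨k, Subtype.ext ?_⟩
  have h1 : (g : Matrix (Fin 2) (Fin 2) ℤ).map (Int.cast : ℤ → ZMod p) = 1 :=
    congrArg (fun x : SL(2, ZMod p) => (x : Matrix (Fin 2) (Fin 2) (ZMod p)))
      (MonoidHom.mem_ker.mp hg)
  have h2 := Matrix.pow_prime_pow_map_intCast_eq_one h1 k
  change Matrix.SpecialLinearGroup.map (Int.castRingHom (ZMod (p ^ (k + 1)))) g ^ p ^ k = 1
  rw [← map_pow]
  exact Subtype.ext h2

/-- The free group of rank two is residually a finite `p`-group. -/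
theorem exists_hom_finite_pGroup_ne_one {p : ℕ} (hp : p.Prime) {w : FreeGroup (Fin 2)}
    (hw : w ≠ 1) : ∃ (P : Type) (_ : Group P) (_ : Finite P),
      IsPGroup p P ∧ ∃ f : FreeGroup (Fin 2) →* P, f w ≠ 1 := by
  set F := FreeGroup.lift (sanovGenerators p) with hF
  have hFw : F w ≠ 1 := fun h =>
    hw (lift_sanovGenerators_injective hp.two_le (h.trans (map_one _).symm))
  have hmem : ∀ v, F v ∈ CongruenceSubgroup.Gamma p := fun v =>
    FreeGroup.range_lift_le (Set.range_subset_iff.mpr (sanovGenerators_mem_Gamma p)) ⟨v, rfl⟩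
  obtain ⟨i, j, hij⟩ : ∃ i j, (F w).1 i j ≠ (1 : Matrix (Fin 2) (Fin 2) ℤ) i j := by
    by_contra! h
    exact hFw (Subtype.ext (Matrix.ext h))
  set d := (F w).1 i j - (1 : Matrix (Fin 2) (Fin 2) ℤ) i j with hd
  have hd0 : d ≠ 0 := sub_ne_zero.mpr hij
  -- Any modulus exceeding `|d|` detects the nonzero entry `d`, and `p ^ (|d| + 1) > |d|`.
  let k := d.natAbs
  have : NeZero (p ^ (k + 1)) := ⟨pow_ne_zero _ hp.ne_zero⟩
  let π := Matrix.SpecialLinearGroup.map (n := Fin 2) (Int.castRingHom (ZMod (p ^ (k + 1))))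
  refine ⟨(CongruenceSubgroup.Gamma p).map π, inferInstance, inferInstance,
    isPGroup_map_Gamma p k, (π.comp F).codRestrict _ fun v => ⟨F v, hmem v, rfl⟩, fun h => ?_⟩
  have h1 : (F w).1.map (Int.cast : ℤ → ZMod (p ^ (k + 1))) = 1 :=
    congrArg Subtype.val (congrArg Subtype.val h)
  have h2 := congrFun (congrFun h1 i) j
  have h3 : ((d : ℤ) : ZMod (p ^ (k + 1))) = 0 := by
    rw [Matrix.map_apply, Matrix.one_apply] at h2
    rw [hd, Int.cast_sub, h2, Matrix.one_apply]
    split_ifs <;> simp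
  rw [ZMod.intCast_zmod_eq_zero_iff_dvd, Int.natCast_dvd] at h3
  have h4 := Nat.le_of_dvd (Int.natAbs_pos.mpr hd0) h3
  have h5 : k + 1 < p ^ (k + 1) := Nat.lt_pow_self hp.one_lt
  omega

/-! ### Residual `p`-finiteness when the matrix is unipotent modulo `p` -/

namespace FreeByCyclic

/-- If the induced matrix is unipotent modulo `p`, then powers of `φ` of sufficiently high
`p`-power exponent have trivial matrix modulo any given power of `p`. -/
theorem inducedMatrix_pow_map_eq_one {p : ℕ} (hp : p.Prime) {φ : MulAut F2}
    (hφ : ((inducedMatrix φ).map (Int.cast : ℤ → ZMod p) - 1) ^ 2 = 0) (k : ℕ) :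
    (inducedMatrix (φ ^ p ^ (k + 1))).map (Int.cast : ℤ → ZMod (p ^ (k + 1))) = 1 := by
  have := Fact.mk hp
  have h1 : (inducedMatrix φ ^ p).map (Int.cast : ℤ → ZMod p) = 1 := by
    have e : (inducedMatrix φ ^ p).map (Int.cast : ℤ → ZMod p) =
        (inducedMatrix φ).map (Int.cast : ℤ → ZMod p) ^ p :=
      map_pow (Int.castRingHom (ZMod p)).mapMatrix (inducedMatrix φ) p
    -- Frobenius: `A ^ p - 1 = (A - 1) ^ p` modulo `p`, which vanishes since `p ≥ 2`.
    have h := sub_pow_char_of_commute (p := p)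
      (Commute.one_right ((inducedMatrix φ).map (Int.cast : ℤ → ZMod p)))
    rw [pow_eq_zero_of_le hp.two_le hφ, one_pow] at h
    rw [e, ← sub_eq_zero, ← h]
  have h2 := Matrix.pow_prime_pow_map_intCast_eq_one h1 k
  rwa [← pow_mul, ← pow_succ', ← inducedMatrix_pow] at h2

open scoped IsMulCommutative in
-- Induction on `P / Z(P)`. Some `ψ = φ ^ p ^ r` acts trivially on homomorphisms to `P / Z(P)` and
-- to `Z(P)`. Then `f ∘ ψ = f · ζ` with `ζ` central-valued and `ψ`-invariant, so `f ∘ ψ ^ m = f · ζ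
-- ^ m`, and a further `p`-power kills `ζ`.
theorem comp_pow_prime_pow_eq {p : ℕ} (hp : p.Prime) {φ : MulAut F2}
    (hφ : ((inducedMatrix φ).map (Int.cast : ℤ → ZMod p) - 1) ^ 2 = 0)
    (P : Type) [Group P] [Group.IsNilpotent P] :
    Finite P → IsPGroup p P → ∃ s : ℕ, ∀ (f : F2 →* P) (w : F2), f ((φ ^ p ^ s) w) = f w := by
  refine Group.nilpotent_center_quotient_ind (P := fun P _ _ => Finite P → IsPGroup p P →
    ∃ s : ℕ, ∀ (f : F2 →* P) (w : F2), f ((φ ^ p ^ s) w) = f w) P ?_ ?_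
  · exact fun P _ _ _ _ => ⟨0, fun f w => Subsingleton.elim _ _⟩
  · intro P _ _ ih hfin hP
    have := Fact.mk hp
    obtain ⟨s, hs⟩ := ih inferInstance (hP.to_quotient _)
    obtain ⟨n, hn⟩ := IsPGroup.iff_card.mp (hP.to_subgroup (Subgroup.center P))
    have hC : ∀ c : Subgroup.center P, c ^ p ^ (n + 1) = 1 := fun c => by
      rw [pow_succ, pow_mul, ← hn, pow_card_eq_one', one_pow]
    obtain ⟨ψ, hψ⟩ : ∃ ψ, ψ = φ ^ p ^ (max s (n + 1)) := ⟨_, rfl⟩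
    have hq : ∀ (f : F2 →* P ⧸ Subgroup.center P) (w : F2), f (ψ w) = f w := by
      intro f w
      have : ∀ (m : ℕ) (v : F2), f (((φ ^ p ^ s) ^ m) v) = f v := by
        intro m
        induction m with
        | zero => intro v; simp
        | succ m ihm => intro v; rw [pow_succ, MulAut.mul_apply, ihm, hs]
      rw [hψ, ← Nat.add_sub_of_le (le_max_left s (n + 1)), pow_add, pow_mul, this]
    have hc : ∀ (ζ : F2 →* Subgroup.center P) (w : F2), ζ (ψ w) = ζ w := by
      intro ζ w
      have h0 := map_aut_eq_of_matrix_eq_one (C := Subgroup.center P)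
          (inducedMatrix_pow_map_eq_one hp hφ n) hC ζ
      have : ∀ (m : ℕ) (v : F2), ζ (((φ ^ p ^ (n + 1)) ^ m) v) = ζ v := by
        intro m
        induction m with
        | zero => intro v; simp
        | succ m ihm => intro v; rw [pow_succ, MulAut.mul_apply, ihm, h0]
      rw [hψ, ← Nat.add_sub_of_le (le_max_right s (n + 1)), pow_add, pow_mul, this]
    refine ⟨max s (n + 1) + (n + 1), fun f w => ?_⟩
    have hmem : ∀ w, (f w)⁻¹ * f (ψ w) ∈ Subgroup.center P := fun w =>
      QuotientGroup.eq.mp (hq ((QuotientGroup.mk' _).comp f) w).symm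
    let ζ : F2 →* Subgroup.center P := MonoidHom.mk' (fun w => ⟨(f w)⁻¹ * f (ψ w), hmem w⟩) <| by
      intro a b
      apply Subtype.ext
      have := Subgroup.mem_center_iff.mp (hmem a) (f b)⁻¹
      simp only [map_mul, mul_inv_rev, Subgroup.coe_mul]
      rw [mul_assoc, ← mul_assoc (f a)⁻¹, ← mul_assoc, this]
      group
    have hζ : ∀ w, f (ψ w) = f w * ζ w := fun w => by simp [ζ]
    have hpow : ∀ (m : ℕ) (w : F2), f ((ψ ^ m) w) = f w * (ζ w ^ m : Subgroup.center P) := by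
      intro m
      induction m with
      | zero => intro w; simp
      | succ m ihm =>
        intro w
        rw [pow_succ, MulAut.mul_apply, ihm, hζ, hc, pow_succ', Subgroup.coe_mul, mul_assoc]
    rw [pow_add, pow_mul, ← hψ, hpow, hC, Subgroup.coe_one, mul_one]

/-- Automorphisms of `F₂` permute the homomorphisms to `P` by precomposition. -/
def permHom (P : Type) [Group P] : MulAut F2 →* Equiv.Perm (F2 →* P) where
  toFun α :=
    { toFun := fun f => f.comp α⁻¹.toMonoidHom
      invFun := fun f => f.comp α.toMonoidHom
      left_inv := fun f => by ext; simp
      right_inv := fun f => by ext; simp }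
  map_one' := rfl
  map_mul' _ _ := rfl

/-- The homomorphism from `F₂ ⋊_φ ℤ` to the permutational wreath product of `P` by the cyclic
group of permutations of the homomorphisms from `F₂` to `P` induced by `φ`. -/
def toWreath (φ : MulAut F2) (P : Type) [Group P] :
    G φ →* ((F2 →* P) → P) ⋊[mulAutArrow] ((permHom P).comp (action φ)).range :=
  SemidirectProduct.map (MonoidHom.pi fun f => f) ((permHom P).comp (action φ)).rangeRestrict
    fun g => by
      refine MonoidHom.ext fun w => funext fun f => ?_
      change f (action φ g w) = (permHom P (action φ g)⁻¹ f) w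
      simp [permHom]

theorem isResiduallyPFinite_of_exists_hom {p : ℕ} {H : Type} [Group H]
    (h : ∀ g : H, g ≠ 1 → ∃ (Q : Type) (_ : Group Q) (_ : Finite Q),
      IsPGroup p Q ∧ ∃ f : H →* Q, f g ≠ 1) : IsResiduallyPFinite p H := by
  intro g hg
  obtain ⟨Q, _, _, hQ, f, hf⟩ := h g hg
  have hi := QuotientGroup.kerLift_injective f
  exact ⟨f.ker, inferInstance, hf, Finite.of_injective _ hi, hQ.of_injective _ hi⟩

theorem isResiduallyPFinite_of_unipotent {p : ℕ} (hp : p.Prime) {φ : MulAut F2}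
    (hφ : ((inducedMatrix φ).map (Int.cast : ℤ → ZMod p) - 1) ^ 2 = 0) :
    IsResiduallyPFinite p (G φ) := by
  have := Fact.mk hp
  refine isResiduallyPFinite_of_exists_hom fun g hg => ?_
  by_cases hr : g.right = 1
  · have hl : g.left ≠ 1 := fun hl => hg (SemidirectProduct.ext hl hr)
    obtain ⟨P, _, _, hP, f, hf⟩ := exists_hom_finite_pGroup_ne_one hp hl
    have := hP.isNilpotent
    obtain ⟨s, hs⟩ := comp_pow_prime_pow_eq hp hφ P inferInstance hP
    have : Finite (F2 →* P) := Finite.of_equiv _ (FreeGroup.lift (α := Fin 2) (β := P))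
    have hR : IsPGroup p ((permHom P).comp (action φ)).range := by
      rintro ⟨_, n, rfl⟩
      refine ⟨s, Subtype.ext ?_⟩
      have h1 : permHom P (φ ^ p ^ s)⁻¹ = 1 := by
        ext f w
        simpa [permHom] using hs f _
      have h2 : (permHom P).comp (action φ) n = (permHom P φ⁻¹) ^ n.toAdd := by
        simp [action]
      change ((permHom P).comp (action φ) n) ^ p ^ s = 1
      rw [h2, ← zpow_natCast, ← zpow_mul, mul_comm, zpow_mul, zpow_natCast, ← map_pow, inv_pow,
        h1, one_zpow]
    have hA : IsPGroup p ((F2 →* P) → P) := by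
      obtain ⟨n, hn⟩ := IsPGroup.iff_card.mp hP
      refine IsPGroup.of_card (n := n * Nat.card (F2 →* P)) ?_
      rw [Nat.card_fun, hn, pow_mul]
    obtain ⟨a, ha⟩ := IsPGroup.iff_card.mp hA
    obtain ⟨b, hb⟩ := IsPGroup.iff_card.mp hR
    -- The `f`-coordinate of the image of `g` in the wreath product is `f g.left`.
    refine ⟨_, inferInstance, Finite.of_equiv _ SemidirectProduct.equivProd.symm,
      IsPGroup.of_card (n := a + b) ?_, toWreath φ P, fun h => hf ?_⟩
    · rw [SemidirectProduct.card, ha, hb, pow_add]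
    · exact congrFun (congrArg SemidirectProduct.left h) f
  -- Elements outside the fibre already survive in a cyclic quotient of `ℤ` of order `p ^ k > k`.
  · let k := g.right.toAdd.natAbs
    have hk : 0 < k := Int.natAbs_pos.mpr fun h => hr h
    have : NeZero (p ^ k) := ⟨pow_ne_zero _ hp.ne_zero⟩
    refine ⟨Multiplicative (ZMod (p ^ k)), inferInstance, inferInstance,
      IsPGroup.of_card (n := k) ?_,
      (AddMonoidHom.toMultiplicative (Int.castAddHom (ZMod (p ^ k)))).comp
        SemidirectProduct.rightHom, fun h => ?_⟩
    · rw [Nat.card_congr Multiplicative.toAdd, Nat.card_zmod]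
    · have h1 : ((g.right.toAdd : ℤ) : ZMod (p ^ k)) = 0 := h
      rw [ZMod.intCast_zmod_eq_zero_iff_dvd, Int.natCast_dvd] at h1
      exact absurd (Nat.le_of_dvd hk h1) (not_le.mpr (Nat.lt_pow_self hp.one_lt))

/-- Cayley–Hamilton: modulo `p` the characteristic polynomial is `(X - 1) ^ 2`. -/
theorem sq_map_sub_one_eq_zero {p : ℕ} {M : Matrix (Fin 2) (Fin 2) ℤ}
    (htr : (p : ℤ) ∣ M.trace - 2) (hdet : (p : ℤ) ∣ M.det - 1) :
    (M.map (Int.cast : ℤ → ZMod p) - 1) ^ 2 = 0 := by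
  rw [← ZMod.intCast_zmod_eq_zero_iff_dvd] at htr hdet
  rw [Matrix.trace_fin_two] at htr
  rw [Matrix.det_fin_two] at hdet
  push_cast at htr hdet
  ext i j
  fin_cases i <;> fin_cases j <;>
    simp [pow_two, Matrix.mul_apply, Fin.sum_univ_two] <;> grind

theorem isResiduallyPFinite_of_dvd {p : ℕ} (hp : p.Prime) {φ : MulAut F2}
    (htr : (p : ℤ) ∣ (inducedMatrix φ).trace - 2) (hdet : (p : ℤ) ∣ (inducedMatrix φ).det - 1) :
    IsResiduallyPFinite p (G φ) :=
  isResiduallyPFinite_of_unipotent hp (sq_map_sub_one_eq_zero htr hdet)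

theorem isResiduallyNilpotent_of_isResiduallyPFinite {p : ℕ} (hp : p.Prime) {H : Type*} [Group H]
    (h : IsResiduallyPFinite p H) : IsResiduallyNilpotent H := by
  have := Fact.mk hp
  intro g hg
  obtain ⟨N, hN, hgN, hfin, hP⟩ := h g hg
  exact ⟨N, hN, hgN, hP.isNilpotent⟩

end FreeByCyclic

/-! ### Powers in iterated commutator subgroups -/

section Commutators

open scoped commutatorElement

variable {H : Type*} [Group H]

theorem commutatorElement_mul_left_of_mem_center {a b c : H} (h : ⁅b, c⁆ ∈ Subgroup.center H) :
    ⁅a * b, c⁆ = ⁅a, c⁆ * ⁅b, c⁆ := by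
  have h1 : ⁅a * b, c⁆ = a * ⁅b, c⁆ * a⁻¹ * ⁅a, c⁆ := by
    simp only [commutatorElement_def]; group
  rw [h1, Subgroup.mem_center_iff.mp h a, mul_inv_cancel_right,
    Subgroup.mem_center_iff.mp h]

theorem commutatorElement_pow_left_of_mem_center {a c : H} (h : ⁅a, c⁆ ∈ Subgroup.center H)
    (n : ℕ) : ⁅a ^ n, c⁆ = ⁅a, c⁆ ^ n := by
  induction n with
  | zero => simp
  | succ n ih => rw [pow_succ, commutatorElement_mul_left_of_mem_center h, ih, pow_succ]

/-- If `n`-th powers of elements of `K` lie in `⁅K, H⁆`, then `n`-th powers of elements of `⁅K, H⁆`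
lie in `⁅⁅K, H⁆, H⁆`. -/
theorem Subgroup.pow_mem_commutator_commutator_top {K : Subgroup H} [K.Normal] {n : ℕ}
    (h : ∀ a ∈ K, a ^ n ∈ ⁅K, (⊤ : Subgroup H)⁆) {a : H} (ha : a ∈ ⁅K, (⊤ : Subgroup H)⁆) :
    a ^ n ∈ ⁅⁅K, (⊤ : Subgroup H)⁆, (⊤ : Subgroup H)⁆ := by
  set L := ⁅⁅K, (⊤ : Subgroup H)⁆, (⊤ : Subgroup H)⁆ with hL
  let π := QuotientGroup.mk' L
  have hc : ∀ b ∈ ⁅K, (⊤ : Subgroup H)⁆, π b ∈ Subgroup.center (H ⧸ L) := by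
    intro b hb
    rw [Subgroup.mem_center_iff]
    intro g
    obtain ⟨g, rfl⟩ := QuotientGroup.mk'_surjective L g
    have : π ⁅b, g⁆ = 1 :=
      (QuotientGroup.eq_one_iff _).mpr (Subgroup.commutator_mem_commutator hb (Subgroup.mem_top g))
    rw [map_commutatorElement, commutatorElement_eq_one_iff_mul_comm] at this
    exact this.symm
  suffices π a ^ n = 1 from (QuotientGroup.eq_one_iff _).mp this
  rw [Subgroup.commutator_def] at ha
  induction ha using Subgroup.closure_induction with
  | mem x hx =>
    obtain ⟨b, hb, g, hg, rfl⟩ := hx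
    rw [map_commutatorElement, ← commutatorElement_pow_left_of_mem_center, ← map_pow,
      ← map_commutatorElement]
    · exact (QuotientGroup.eq_one_iff _).mpr (Subgroup.commutator_mem_commutator (h b hb) hg)
    · rw [← map_commutatorElement]
      exact hc _ (Subgroup.commutator_mem_commutator hb hg)
  | one => simp
  | mul x y hx hy ihx ihy =>
    have : Commute (π x) (π y) := (Subgroup.mem_center_iff.mp (hc x hx) (π y)).symm
    rw [map_mul, this.mul_pow, ihx, ihy, one_mul]
  | inv x hx ih => rw [map_inv, inv_pow, ih, inv_one]

/-- The iterated commutators `⁅…⁅⁅K, H⁆, H⁆…, H⁆`. -/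
def Subgroup.commutatorSeries (K : Subgroup H) : ℕ → Subgroup H
  | 0 => K
  | n + 1 => ⁅K.commutatorSeries n, (⊤ : Subgroup H)⁆

instance Subgroup.commutatorSeries_normal (K : Subgroup H) [K.Normal] (n : ℕ) :
    (K.commutatorSeries n).Normal := by
  induction n with
  | zero => assumption
  | succ n ih => exact Subgroup.commutator_normal _ _

theorem Subgroup.commutatorSeries_le_lowerCentralSeries (K : Subgroup H) (n : ℕ) :
    K.commutatorSeries n ≤ (⊤ : Subgroup H).lowerCentralSeries n := by
  induction n with
  | zero => exact le_top
  | succ n ih => exact Subgroup.commutator_mono ih le_rfl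

theorem Subgroup.pow_pow_mem_lowerCentralSeries {K : Subgroup H} [K.Normal] {m : ℕ}
    (h : ∀ a ∈ K, a ^ m ∈ ⁅K, (⊤ : Subgroup H)⁆) {a : H} (ha : a ∈ K) (n : ℕ) :
    a ^ m ^ n ∈ (⊤ : Subgroup H).lowerCentralSeries n := by
  have h1 : ∀ n, ∀ b ∈ K.commutatorSeries n, b ^ m ∈ K.commutatorSeries (n + 1) := by
    intro n
    induction n with
    | zero => exact h
    | succ n ih => exact fun b hb => Subgroup.pow_mem_commutator_commutator_top ih hb
  refine K.commutatorSeries_le_lowerCentralSeries n ?_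
  induction n with
  | zero => rw [pow_zero, pow_one]; exact ha
  | succ n ih =>
    rw [pow_succ, pow_mul]
    exact h1 n _ ih

end Commutators

theorem IsResiduallyNilpotent.eq_one {H : Type*} [Group H] (h : IsResiduallyNilpotent H) {g : H}
    (hg : ∀ n, g ∈ (⊤ : Subgroup H).lowerCentralSeries n) : g = 1 := by
  by_contra hne
  obtain ⟨N, hN, hgN, hnil⟩ := h g hne
  obtain ⟨n, hn⟩ := Subgroup.nilpotent_iff_lowerCentralSeries.mp hnil
  refine hgN ((QuotientGroup.eq_one_iff g).mp ?_)
  have h1 := Subgroup.map_lowerCentralSeries (⊤ : Subgroup H) (QuotientGroup.mk' N) n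
  rw [Subgroup.map_top_of_surjective _ (QuotientGroup.mk'_surjective N), hn] at h1
  have h2 := Subgroup.mem_map_of_mem (QuotientGroup.mk' N) (hg n)
  rwa [h1] at h2

/-! ### Obstructions to residual nilpotence -/

namespace FreeByCyclic

open scoped commutatorElement

/-- The exponent sum of the `i`-th generator. -/
def exponentSum (i : Fin 2) : F2 →* Multiplicative ℤ :=
  FreeGroup.lift fun j => Multiplicative.ofAdd (if j = i then 1 else 0)

theorem exponentSum_aut_of (φ : MulAut F2) (i j : Fin 2) :
    (exponentSum i (φ (FreeGroup.of j))).toAdd = inducedMatrix φ i j := by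
  rw [map_aut_of]
  fin_cases i <;> simp [exponentSum]

/-- If the commutator of the images of the generators is central, then commutators are given by the
determinant of the exponent sums. -/
theorem commutatorElement_map_eq_zpow {H : Type*} [Group H] (f : F2 →* H) {c : H}
    (hc : ⁅f (FreeGroup.of 0), f (FreeGroup.of 1)⁆ = c) (hz : c ∈ Subgroup.center H) (u v : F2) :
    ⁅f u, f v⁆ = c ^ ((exponentSum 0 u).toAdd * (exponentSum 1 v).toAdd -
      (exponentSum 1 u).toAdd * (exponentSum 0 v).toAdd) := by
  have hzc : ∀ n : ℤ, c ^ n ∈ Subgroup.center H := fun n => zpow_mem hz n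
  have inv_left : ∀ {a b : H}, ⁅a, b⁆ ∈ Subgroup.center H → ⁅a⁻¹, b⁆ = ⁅a, b⁆⁻¹ := by
    intro a b h
    have h1 := commutatorElement_mul_left_of_mem_center (a := a⁻¹) h
    rw [inv_mul_cancel, commutatorElement_one_left] at h1
    exact eq_inv_of_mul_eq_one_left h1.symm
  have hgen : ∀ (j : Fin 2) (u : F2), ⁅f u, f (FreeGroup.of j)⁆ =
      c ^ ((exponentSum 0 u).toAdd * (exponentSum 1 (.of j)).toAdd -
      (exponentSum 1 u).toAdd * (exponentSum 0 (.of j)).toAdd) := by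
    intro j u
    induction u using FreeGroup.induction_on with
    | C1 => simp
    | of i =>
      fin_cases i <;> fin_cases j <;> simp [exponentSum, hc]
      rw [← commutatorElement_inv, hc]
    | inv_of i ih =>
      change ⁅f (FreeGroup.of i)⁻¹, _⁆ = _
      rw [map_inv, inv_left (ih ▸ hzc _), ih, ← zpow_neg]
      congr 1
      simp only [map_inv, toAdd_inv]
      ring
    | mul a b iha ihb =>
      rw [map_mul, commutatorElement_mul_left_of_mem_center (ihb ▸ hzc _), iha, ihb, ← zpow_add]
      congr 1
      simp only [map_mul, toAdd_mul]
      ring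
  have hgen' : ∀ (j : Fin 2) (u : F2), ⁅f (FreeGroup.of j), f u⁆ =
      c ^ ((exponentSum 0 (.of j)).toAdd * (exponentSum 1 u).toAdd -
      (exponentSum 1 (.of j)).toAdd * (exponentSum 0 u).toAdd) := by
    intro j u
    rw [← commutatorElement_inv, hgen, ← zpow_neg]
    congr 1
    ring
  induction u using FreeGroup.induction_on with
  | C1 => simp
  | of i => exact hgen' i v
  | inv_of i ih =>
    change ⁅f (FreeGroup.of i)⁻¹, _⁆ = _
    rw [map_inv, inv_left (ih ▸ hzc _), ih, ← zpow_neg]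
    congr 1
    simp only [map_inv, toAdd_inv]
    ring
  | mul a b iha ihb =>
    rw [map_mul, commutatorElement_mul_left_of_mem_center (ihb ▸ hzc _), iha, ihb, ← zpow_add]
    congr 1
    simp only [map_mul, toAdd_mul]
    ring

/-- The fibre `F₂` as a normal subgroup of `F₂ ⋊_φ ℤ`. -/
def fiber (φ : MulAut F2) : Subgroup (G φ) := (SemidirectProduct.rightHom : G φ →* _).ker

instance (φ : MulAut F2) : (fiber φ).Normal := inferInstanceAs (MonoidHom.ker _).Normal

theorem inl_mem_fiber (φ : MulAut F2) (w : F2) :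
    (SemidirectProduct.inl w : G φ) ∈ fiber φ := by
  simp [fiber, MonoidHom.mem_ker]

open scoped IsMulCommutative in
-- Modulo `⁅F₂, G⁆` the fibre becomes central and `φ` acts trivially on it, so its generators
-- satisfy the linear relations with matrix `A - 1`; Cramer's rule makes `det (A - 1)` annihilate
-- them.
theorem pow_mem_commutator_fiber (φ : MulAut F2) {a : G φ} (ha : a ∈ fiber φ) :
    a ^ (1 - (inducedMatrix φ).trace + (inducedMatrix φ).det).natAbs ∈
      ⁅fiber φ, (⊤ : Subgroup (G φ))⁆ := by
  set L := ⁅fiber φ, (⊤ : Subgroup (G φ))⁆ with hL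
  let π := QuotientGroup.mk' L
  have hz : ∀ w : F2, π (SemidirectProduct.inl w) ∈ Subgroup.center (G φ ⧸ L) := by
    intro w
    rw [Subgroup.mem_center_iff]
    intro g
    obtain ⟨g, rfl⟩ := QuotientGroup.mk'_surjective L g
    have : π ⁅(SemidirectProduct.inl w : G φ), g⁆ = 1 := (QuotientGroup.eq_one_iff _).mpr
      (Subgroup.commutator_mem_commutator (inl_mem_fiber φ w) (Subgroup.mem_top g))
    rw [map_commutatorElement, commutatorElement_eq_one_iff_mul_comm] at this
    exact this.symm
  let f : F2 →* Subgroup.center (G φ ⧸ L) :=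
    (π.comp SemidirectProduct.inl).codRestrict _ hz
  have hf : ∀ w, f (φ w) = f w := by
    intro w
    apply Subtype.ext
    change π (SemidirectProduct.inl (φ w)) = π (SemidirectProduct.inl w)
    rw [← conj_t, map_mul, map_mul, mul_assoc, ← Subgroup.mem_center_iff.mp (hz w), ← mul_assoc,
      ← map_mul, inv_mul_cancel, map_one, one_mul]
  set m := (1 - (inducedMatrix φ).trace + (inducedMatrix φ).det) with hm
  have h0 := map_aut_of (C := Subgroup.center (G φ ⧸ L)) φ f 0
  have h1 := map_aut_of (C := Subgroup.center (G φ ⧸ L)) φ f 1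
  rw [hf, Fin.prod_univ_two] at h0 h1
  set X := f (FreeGroup.of 0)
  set Y := f (FreeGroup.of 1)
  have hm' : m = (inducedMatrix φ 0 0 - 1) * (inducedMatrix φ 1 1 - 1) -
      inducedMatrix φ 0 1 * inducedMatrix φ 1 0 := by
    rw [hm, Matrix.trace_fin_two, Matrix.det_fin_two]; ring
  have e0 : X ^ (inducedMatrix φ 0 0 - 1) * Y ^ inducedMatrix φ 1 0 = 1 := by
    rw [zpow_sub_one, mul_right_comm, ← h0, mul_inv_cancel]
  have e1 : X ^ (inducedMatrix φ 0 1) * Y ^ (inducedMatrix φ 1 1 - 1) = 1 := by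
    rw [zpow_sub_one, ← mul_assoc, ← h1, mul_inv_cancel]
  have hX : X ^ m = 1 := by
    have : X ^ m = (X ^ (inducedMatrix φ 0 0 - 1) * Y ^ inducedMatrix φ 1 0) ^
        (inducedMatrix φ 1 1 - 1) * ((X ^ (inducedMatrix φ 0 1) *
        Y ^ (inducedMatrix φ 1 1 - 1)) ^ (inducedMatrix φ 1 0))⁻¹ := by
      rw [mul_zpow, mul_zpow, ← zpow_mul, ← zpow_mul, ← zpow_mul, ← zpow_mul, mul_inv, hm',
        zpow_sub, mul_comm (inducedMatrix φ 1 0) (inducedMatrix φ 1 1 - 1), mul_mul_mul_comm,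
        mul_inv_cancel, mul_one]
    rw [this, e0, e1, one_zpow, one_zpow, inv_one, one_mul]
  have hY : Y ^ m = 1 := by
    have : Y ^ m = (X ^ (inducedMatrix φ 0 1) * Y ^ (inducedMatrix φ 1 1 - 1)) ^
        (inducedMatrix φ 0 0 - 1) * ((X ^ (inducedMatrix φ 0 0 - 1) *
        Y ^ inducedMatrix φ 1 0) ^ (inducedMatrix φ 0 1))⁻¹ := by
      rw [mul_zpow, mul_zpow, ← zpow_mul, ← zpow_mul, ← zpow_mul, ← zpow_mul, mul_inv, hm',
        zpow_sub, mul_comm (inducedMatrix φ 0 1) (inducedMatrix φ 0 0 - 1), mul_mul_mul_comm,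
        mul_inv_cancel, one_mul, mul_comm (inducedMatrix φ 0 1) (inducedMatrix φ 1 0),
        mul_comm (inducedMatrix φ 1 1 - 1)]
    rw [this, e0, e1, one_zpow, one_zpow, inv_one, one_mul]
  have hw : ∀ w, f w ^ m = 1 := by
    intro w
    have : (zpowGroupHom m).comp f = 1 := by
      ext j
      fin_cases j
      · exact congrArg Subtype.val hX
      · exact congrArg Subtype.val hY
    exact DFunLike.congr_fun this w
  obtain ⟨w, rfl⟩ : a ∈ (SemidirectProduct.inl : F2 →* G φ).range := by
    rw [SemidirectProduct.range_inl_eq_ker_rightHom]; exact ha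
  have h2 : π (SemidirectProduct.inl w) ^ m = 1 := congrArg Subtype.val (hw w)
  refine (QuotientGroup.eq_one_iff _).mp ?_
  change π (SemidirectProduct.inl w ^ m.natAbs) = 1
  rw [map_pow]
  rcases Int.natAbs_eq m with h | h
  · rwa [h, zpow_natCast] at h2
  · rwa [h, zpow_neg, inv_eq_one, zpow_natCast] at h2

/-- The commutator of the two free generators. -/
def generatorsCommutator (φ : MulAut F2) : G φ :=
  SemidirectProduct.inl ⁅(FreeGroup.of 0 : F2), (FreeGroup.of 1 : F2)⁆

theorem generatorsCommutator_ne_one (φ : MulAut F2) : generatorsCommutator φ ≠ 1 := by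
  intro h
  have h1 : ⁅(FreeGroup.of 0 : F2), (FreeGroup.of 1 : F2)⁆ = 1 :=
    SemidirectProduct.inl_injective
      (h.trans (map_one (SemidirectProduct.inl : F2 →* G φ)).symm)
  revert h1
  decide

/-- Once the commutator `c` is central, conjugation by `t` fixes it, while `φ` sends it to `c ^ det
A = c⁻¹`; hence `c ^ 2 = 1`. -/
theorem sq_mem_commutator_normalClosure {φ : MulAut F2} (hdet : (inducedMatrix φ).det = -1)
    {a : G φ} (ha : a ∈ Subgroup.normalClosure {generatorsCommutator φ}) :
    a ^ 2 ∈ ⁅Subgroup.normalClosure {generatorsCommutator φ}, (⊤ : Subgroup (G φ))⁆ := by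
  set K := Subgroup.normalClosure {generatorsCommutator φ} with hK
  set L := ⁅K, (⊤ : Subgroup (G φ))⁆ with hL
  let π := QuotientGroup.mk' L
  have hcK : generatorsCommutator φ ∈ K := Subgroup.subset_normalClosure rfl
  have hz : ∀ b ∈ K, π b ∈ Subgroup.center (G φ ⧸ L) := by
    intro b hb
    rw [Subgroup.mem_center_iff]
    intro g
    obtain ⟨g, rfl⟩ := QuotientGroup.mk'_surjective L g
    have : π ⁅b, g⁆ = 1 :=
      (QuotientGroup.eq_one_iff _).mpr (Subgroup.commutator_mem_commutator hb (Subgroup.mem_top g))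
    rw [map_commutatorElement, commutatorElement_eq_one_iff_mul_comm] at this
    exact this.symm
  have hcz := hz _ hcK
  have hc : π (generatorsCommutator φ) ^ 2 = 1 := by
    have h1 := commutatorElement_map_eq_zpow (π.comp SemidirectProduct.inl)
      (c := π (generatorsCommutator φ)) (by simp [generatorsCommutator, map_commutatorElement]) hcz
      (φ (FreeGroup.of 0)) (φ (FreeGroup.of 1))
    have h2 : (π.comp SemidirectProduct.inl) (φ ⁅(FreeGroup.of 0 : F2), (FreeGroup.of 1 : F2)⁆) =
        π (generatorsCommutator φ) := by
      change π (SemidirectProduct.inl (φ _)) = _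
      rw [← conj_t, map_mul, map_mul, mul_assoc]
      change _ * (π (generatorsCommutator φ) * _) = _
      rw [← Subgroup.mem_center_iff.mp hcz, ← mul_assoc, ← map_mul, inv_mul_cancel, map_one,
        one_mul]
    simp only [exponentSum_aut_of] at h1
    rw [← map_commutatorElement, ← map_commutatorElement, h2] at h1
    have h3 : inducedMatrix φ 0 0 * inducedMatrix φ 1 1 -
        inducedMatrix φ 1 0 * inducedMatrix φ 0 1 = -1 := by
      rw [← hdet, Matrix.det_fin_two]; ring
    rw [h3, zpow_neg_one] at h1
    rw [pow_two]
    exact mul_eq_one_iff_eq_inv.mpr h1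
  suffices π a ^ 2 = 1 from (QuotientGroup.eq_one_iff _).mp this
  rw [hK, Subgroup.normalClosure] at ha
  induction ha using Subgroup.closure_induction with
  | mem x hx =>
    obtain ⟨b, rfl, hb⟩ := Group.mem_conjugatesOfSet_iff.mp hx
    obtain ⟨d, rfl⟩ := isConj_iff.mp hb
    rw [map_mul, map_mul, map_inv, conj_pow, hc, mul_one, mul_inv_cancel]
  | one => simp
  | mul x y hx hy ihx ihy =>
    have : Commute (π x) (π y) := (Subgroup.mem_center_iff.mp (hz x hx) (π y)).symm
    rw [map_mul, this.mul_pow, ihx, ihy, one_mul]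
  | inv x hx ih => rw [map_inv, inv_pow, ih, inv_one]

theorem not_isResiduallyNilpotent {φ : MulAut F2}
    (h : (1 - (inducedMatrix φ).trace + (inducedMatrix φ).det).natAbs = 1 ∨
      (inducedMatrix φ).det = -1 ∧
        Odd (1 - (inducedMatrix φ).trace + (inducedMatrix φ).det).natAbs) :
    ¬ IsResiduallyNilpotent (G φ) := by
  intro hres
  refine generatorsCommutator_ne_one φ (hres.eq_one fun n => ?_)
  have h1 := Subgroup.pow_pow_mem_lowerCentralSeries
    (fun a => pow_mem_commutator_fiber φ) (inl_mem_fiber φ ⁅(FreeGroup.of 0 : F2), (FreeGroup.of 1 : F2)⁆) n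
  change generatorsCommutator φ ^ _ ∈ _ at h1
  rcases h with h | ⟨hdet, hodd⟩
  · simpa only [h, one_pow, pow_one] using h1
  · have h2 := Subgroup.pow_pow_mem_lowerCentralSeries
      (fun a => sq_mem_commutator_normalClosure hdet)
      (Subgroup.subset_normalClosure (Set.mem_singleton (generatorsCommutator φ))) n
    -- The exponents `|m| ^ n` and `2 ^ n` are coprime, so `c` is a product of powers of `c ^ |m| ^
    -- n` and `c ^ 2 ^ n`.
    have hcop : IsCoprime (_ : ℤ) _ :=
      Nat.isCoprime_iff_coprime.mpr (Nat.Coprime.pow n n (Nat.coprime_two_right.mpr hodd))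
    obtain ⟨u, v, huv⟩ := hcop
    rw [← zpow_one (generatorsCommutator φ), ← huv, zpow_add, mul_comm u, mul_comm v, zpow_mul,
      zpow_mul, zpow_natCast, zpow_natCast]
    exact mul_mem (zpow_mem h1 u) (zpow_mem h2 v)

end FreeByCyclic

/-! ### Assembly of the trace and determinant cases -/

theorem mainTheorem1 (φ : MulAut (FreeGroup (Fin 2))) :
    (IsResiduallyNilpotent (FreeByCyclic.G φ) ↔
      ((FreeByCyclic.inducedMatrix φ).det = 1 ∧
          (FreeByCyclic.inducedMatrix φ).trace ∉ ({1, 3} : Set ℤ)) ∨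
        ((FreeByCyclic.inducedMatrix φ).det = -1 ∧
          (FreeByCyclic.inducedMatrix φ).trace ≡ 0 [ZMOD 2])) ∧
    ((FreeByCyclic.inducedMatrix φ).det = 1 →
      ∀ p : ℕ, p.Prime → (p : ℤ) ∣ (FreeByCyclic.inducedMatrix φ).trace - 2 →
        IsResiduallyPFinite p (FreeByCyclic.G φ)) ∧
    ((FreeByCyclic.inducedMatrix φ).det = -1 →
      (FreeByCyclic.inducedMatrix φ).trace ≡ 0 [ZMOD 2] →
        IsResiduallyPFinite 2 (FreeByCyclic.G φ)) := by
  have hs : ∀ p : ℕ, p.Prime → (FreeByCyclic.inducedMatrix φ).det = 1 →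
      (p : ℤ) ∣ (FreeByCyclic.inducedMatrix φ).trace - 2 →
        IsResiduallyPFinite p (FreeByCyclic.G φ) := fun p hp hdet htr =>
    FreeByCyclic.isResiduallyPFinite_of_dvd hp htr (by simp [hdet])
  have hs' : (FreeByCyclic.inducedMatrix φ).det = -1 →
      (FreeByCyclic.inducedMatrix φ).trace ≡ 0 [ZMOD 2] →
        IsResiduallyPFinite 2 (FreeByCyclic.G φ) := fun hdet htr =>
    FreeByCyclic.isResiduallyPFinite_of_dvd Nat.prime_two
      (dvd_sub_self_right.mpr (Int.modEq_zero_iff_dvd.mp htr)) (by norm_num [hdet])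
  refine ⟨⟨fun h => ?_, ?_⟩, fun hdet p hp htr => hs p hp hdet htr, hs'⟩
  · rcases FreeByCyclic.det_inducedMatrix φ with hdet | hdet
    · refine Or.inl ⟨hdet, fun htr => FreeByCyclic.not_isResiduallyNilpotent (Or.inl ?_) h⟩
      rcases htr with htr | htr
      · rw [hdet, htr]; rfl
      · rw [hdet, Set.mem_singleton_iff.mp htr]; rfl
    · refine Or.inr ⟨hdet, ?_⟩
      by_contra htr
      refine FreeByCyclic.not_isResiduallyNilpotent (Or.inr ⟨hdet, ?_⟩) h
      rw [Int.natAbs_odd, hdet, Int.odd_iff]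
      have : ¬ (FreeByCyclic.inducedMatrix φ).trace % 2 = 0 % 2 := htr
      omega
  · rintro (⟨hdet, htr⟩ | ⟨hdet, htr⟩)
    -- Excluding the traces `1` and `3` is exactly what gives `tr A - 2` a prime divisor; trace `2`
    -- gives `0`, divisible by every prime.
    · have hne : ((FreeByCyclic.inducedMatrix φ).trace - 2).natAbs ≠ 1 := fun h1 => htr <| by
        rcases Int.natAbs_eq_iff.mp h1 with h | h
        · exact Or.inr (Set.mem_singleton_iff.mpr (by push_cast at h; linarith))
        · exact Or.inl (by push_cast at h; linarith)
      obtain ⟨p, hp, hpd⟩ := Nat.exists_prime_and_dvd hne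
      exact FreeByCyclic.isResiduallyNilpotent_of_isResiduallyPFinite hp
        (hs p hp hdet (Int.natCast_dvd.mpr hpd))
    · exact FreeByCyclic.isResiduallyNilpotent_of_isResiduallyPFinite Nat.prime_two (hs' hdet htr)
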